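/- Let $K$ be a field and let $V$ be a valuation domain with quotient field $K$, of rank one and not discrete (i.e. $V$ is not a DVR); let $v$ be the associated valuation, with values in $\mathbb{R}\cup\{\infty\}$ (the value group being embedded, as an ordered group, in $\mathbb{R}$). A sequence $E=\{s_n\}_{n\in\mathbb{N}}$ in $K$ is pseudo-convergent if $v(s_{n+1}-s_n)<v(s_{n+2}-s_{n+1})$ for all $n$; its breadth is $\lim_{n} v(s_{n+1}-s_n)\in\mathbb{R}\cup\{+\infty\}$, and $$V_E=\{\phi\in K(X)\mid \phi(s_n)\in V\text{ for all but finitely many }n\},$$ which is a valuation domain of $K(X)$ containing $V$. Let $\mathrm{Zar}(K(X)|V)$ be the set of all valuation domains of $K(X)$ containing $V$. Its Zariski topology is generated by the sets $B(\phi)=\{W\mid\phi\in W\}$, $\phi\in K(X)$, and its constructible topology is the coarsest topology for which all the finite intersections $B(\phi_1,\ldots,\phi_k)=B(\phi_1)\cap\cdots\cap B(\phi_k)$ are both open and closed. Let $\mathcal{V}\subseteq \mathrm{Zar}(K(X)|V)$ be the set of all $V_E$, where $E$ ranges over the pseudo-convergent sequences in $K$, and let $\mathcal{V}(\bullet,\delta)\subseteq\mathcal{V}$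 be the set of all $V_E$ such that $E$ has breadth $\delta$. Two topologies on $\mathrm{Zar}(K(X)|V)$ are said to coincide on a subset if they induce the same subspace topology on it. Then the following are equivalent: 1. the residue field of $V$ is finite; 2. the Zariski and the constructible topologies coincide on $\mathcal{V}$; 3. there is a $\delta\in\mathbb{R}\cup\{+\infty\}$ such that the Zariski and the constructible topologies coincide on $\bigcup_{\delta'\leq\delta}\mathcal{V}(\bullet,\delta')$; 4. there is a $\delta\in\mathbb{R}\cup\{+\infty\}$ such that the Zariski and the constructible topologies coincide on $\bigcup_{\delta'<\delta}\mathcal{V}(\bullet,\delta')$. -/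

import Mathlib

open scoped Polynomial NNReal ENNReal Topology

/-! ### The Zariski space of a domain in a field, with its two topologies -/

/-- The Zariski space `Zar(L|D)`: the set of valuation domains of the field `L` containing
(the image of) `D`. -/
def Zar (D L : Type*) [CommRing D] [Field L] [Algebra D L] : Type _ :=
  {W : ValuationSubring L // ∀ d : D, algebraMap D L d ∈ W}

namespace Zar

variable (D : Type*) {L : Type*} [CommRing D] [Field L] [Algebra D L]

/-- The set `B(φ) = {W ∈ Zar(L|D) | φ ∈ W}`. -/
def basicSet (φ : L) : Set (Zar D L) := {W | φ ∈ W.1}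

/-- The set `B(φ₁, …, φₖ) = {W ∈ Zar(L|D) | φ₁, …, φₖ ∈ W}`. -/
def basicSetFinset (S : Finset L) : Set (Zar D L) := {W | ∀ φ ∈ S, φ ∈ W.1}

variable (L)

/-- The Zariski topology: the sets `B(φ)` form a subbasis of open sets. -/
@[reducible] def zariskiTopology : TopologicalSpace (Zar D L) :=
  TopologicalSpace.generateFrom (Set.range (basicSet D))

/-- The constructible (patch) topology: the coarsest topology for which all the sets
`B(φ₁, …, φₖ)` are both open and closed. -/
@[reducible] def constructibleTopology : TopologicalSpace (Zar D L) :=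
  TopologicalSpace.generateFrom
    {U | ∃ S : Finset L, U = basicSetFinset D S ∨ U = (basicSetFinset D S)ᶜ}

variable {D L}

/-- The Zariski and the constructible topology induce the same topology on the subset `Y`
of the Zariski space. -/
def TopologiesCoincideOn (Y : Set (Zar D L)) : Prop :=
  TopologicalSpace.induced (Subtype.val : Y → Zar D L) (zariskiTopology D L) =
    TopologicalSpace.induced (Subtype.val : Y → Zar D L) (constructibleTopology D L)

end Zar

/-! ### Pseudo-convergent sequences -/

/-- A sequence is pseudo-convergent if `v(s_{n+1} - s_n) < v(s_{n+2} - s_{n+1})` for all `n`, for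
the additively written valuation. Mathlib writes valuations multiplicatively, which reverses the
order. -/
def IsPseudoConvergent {K Γ₀ : Type*} [Field K] [LinearOrderedCommGroupWithZero Γ₀]
    (v : Valuation K Γ₀) (s : ℕ → K) : Prop :=
  ∀ n, v (s (n + 2) - s (n + 1)) < v (s (n + 1) - s n)

/-- The additively written real form `K → ℝ ∪ {∞}` of a rank one valuation:
`x ↦ - log |x|`, where `|x|` is the image of the value of `x` under the
embedding of the value group in the positive reals. In particular `0 ↦ ∞`. -/
noncomputable def addVal {K Γ₀ : Type*} [Field K] [LinearOrderedCommGroupWithZero Γ₀]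
    (v : Valuation K Γ₀) [v.RankOne] (x : K) : EReal :=
  - ENNReal.log ((Valuation.RankOne.hom v (v.restrict x) : ℝ≥0) : ℝ≥0∞)

/-- `δ` is the breadth of the sequence `s`: the limit of `v(s_{n+1} - s_n)` in `ℝ ∪ {∞}`. -/
def HasBreadth {K Γ₀ : Type*} [Field K] [LinearOrderedCommGroupWithZero Γ₀]
    (v : Valuation K Γ₀) [v.RankOne] (s : ℕ → K) (δ : EReal) : Prop :=
  Filter.Tendsto (fun n => addVal v (s (n + 1) - s n)) Filter.atTop (𝓝 δ)

/-! ### The valuation domain of a pseudo-convergent sequence -/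

section Aux

open Filter Polynomial

variable {L Γ : Type*} [Field L] [LinearOrderedCommGroupWithZero Γ] {u : Valuation L Γ}
  {s : ℕ → L}

theorem IsPseudoConvergent.gauge_strictAnti (hs : IsPseudoConvergent u s) :
    StrictAnti fun n => u (s (n + 1) - s n) :=
  strictAnti_nat_of_succ_lt hs

theorem IsPseudoConvergent.gauge_pos (hs : IsPseudoConvergent u s) (n : ℕ) :
    0 < u (s (n + 1) - s n) :=
  zero_le.trans_lt (hs n)

theorem IsPseudoConvergent.val_sub (hs : IsPseudoConvergent u s) (n k : ℕ) :
    u (s (n + k + 1) - s n) = u (s (n + 1) - s n) := by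
  induction k with
  | zero => rfl
  | succ k ih =>
    have h : s (n + (k + 1) + 1) - s n =
        (s (n + (k + 1) + 1) - s (n + (k + 1))) + (s (n + k + 1) - s n) := by
      rw [show n + (k + 1) = n + k + 1 from rfl]; ring
    rw [h, Valuation.map_add_eq_of_lt_right, ih]
    rw [ih]
    exact hs.gauge_strictAnti (by omega)

theorem IsPseudoConvergent.val_sub_const (hs : IsPseudoConvergent u s) (α : L) :
    (∃ c : Γ, c ≠ 0 ∧ ∀ᶠ n in atTop, u (s n - α) = c) ∨
      ∀ᶠ n in atTop, u (s n - α) = u (s (n + 1) - s n) := by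
  by_cases h : ∃ N, u (s (N + 1) - s N) < u (s N - α)
  · obtain ⟨N, hN⟩ := h
    refine Or.inl ⟨u (s N - α), (zero_le.trans_lt hN).ne', ?_⟩
    filter_upwards [eventually_gt_atTop N] with n hn
    obtain ⟨k, rfl⟩ : ∃ k, n = N + k + 1 := ⟨n - N - 1, by omega⟩
    rw [show s (N + k + 1) - α = (s (N + k + 1) - s N) + (s N - α) by ring,
      Valuation.map_add_eq_of_lt_right]
    rwa [hs.val_sub]
  · push Not at h
    refine Or.inr (Eventually.of_forall fun n => ?_)
    rw [show s n - α = (s (n + 1) - α) + -(s (n + 1) - s n) by ring,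
      Valuation.map_add_eq_of_lt_right, Valuation.map_neg]
    rw [Valuation.map_neg]
    exact (h (n + 1)).trans_lt (hs n)

theorem IsPseudoConvergent.val_eval [IsAlgClosed L] (hs : IsPseudoConvergent u s)
    (f : L[X]) (hf : f ≠ 0) :
    ∃ c : Γ, c ≠ 0 ∧ ∃ k : ℕ, ∀ᶠ n in atTop,
      u (f.eval (s n)) = c * u (s (n + 1) - s n) ^ k := by
  have key : ∀ m : Multiset L, ∃ c : Γ, c ≠ 0 ∧ ∃ k : ℕ, ∀ᶠ n in atTop,
      u (((m.map fun a => X - C a).prod).eval (s n)) = c * u (s (n + 1) - s n) ^ k := by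
    intro m
    induction m using Multiset.induction_on with
    | empty => exact ⟨1, one_ne_zero, 0, by simp⟩
    | cons a m ih =>
      obtain ⟨c, hc, k, h⟩ := ih
      rcases hs.val_sub_const a with ⟨c', hc', h'⟩ | h'
      · refine ⟨c' * c, mul_ne_zero hc' hc, k, ?_⟩
        filter_upwards [h, h'] with n h h'
        simp [h, h', mul_assoc]
      · refine ⟨c, hc, k + 1, ?_⟩
        filter_upwards [h, h'] with n h h'
        simp only [Multiset.map_cons, Multiset.prod_cons, eval_mul, map_mul, h, eval_sub, eval_X,
          eval_C, h', pow_succ]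
        rw [mul_comm, mul_assoc]
  obtain ⟨c, hc, k, h⟩ := key f.roots
  refine ⟨u f.leadingCoeff * c, mul_ne_zero (by simpa using hf) hc, k, ?_⟩
  filter_upwards [h] with n h
  conv_lhs => rw [(IsAlgClosed.splits f).eq_prod_roots]
  simp [h, mul_assoc]

theorem mul_pow_compare {d : ℕ → Γ} (hd : StrictAnti d) (c : Γ) {c' : Γ} (m : ℕ) :
    (∀ᶠ n in atTop, c ≤ c' * d n ^ m) ∨ ∀ᶠ n in atTop, c' * d n ^ m ≤ c := by
  by_cases h : ∃ N, c' * d N ^ m ≤ c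
  · obtain ⟨N, hN⟩ := h
    refine Or.inr ?_
    filter_upwards [eventually_ge_atTop N] with n hn
    exact (mul_le_mul_right (pow_le_pow_left' (hd.antitone hn) m) c').trans hN
  · push Not at h
    exact Or.inl (Eventually.of_forall fun n => (h n).le)

theorem IsPseudoConvergent.val_eval_compare [IsAlgClosed L] (hs : IsPseudoConvergent u s)
    {f g : L[X]} (hf : f ≠ 0) (hg : g ≠ 0) :
    (∀ᶠ n in atTop, u (f.eval (s n)) ≤ u (g.eval (s n))) ∨
      ∀ᶠ n in atTop, u (g.eval (s n)) ≤ u (f.eval (s n)) := by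
  obtain ⟨c, -, k, h⟩ := hs.val_eval f hf
  obtain ⟨c', -, l, h'⟩ := hs.val_eval g hg
  rcases le_total k l with hkl | hkl
  · obtain ⟨m, rfl⟩ := Nat.exists_eq_add_of_le hkl
    refine (mul_pow_compare hs.gauge_strictAnti c (c' := c') m).imp ?_ ?_ <;> intro H <;>
    · filter_upwards [h, h', H] with n h h' H
      rw [h, h', pow_add, mul_left_comm, mul_comm c]
      exact mul_le_mul_right H _
  · obtain ⟨m, rfl⟩ := Nat.exists_eq_add_of_le hkl
    refine (mul_pow_compare hs.gauge_strictAnti c' (c' := c) m).symm.imp ?_ ?_ <;> intro H <;>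
    · filter_upwards [h, h', H] with n h h' H
      rw [h, h', pow_add, mul_left_comm, mul_comm c']
      exact mul_le_mul_right H _

end Aux

namespace ValuationSubring

open Filter

variable {K : Type*} [Field K] (V : ValuationSubring K)

/-- `φ(a)` is defined and belongs to `V`. -/
def EvalMem (φ : RatFunc K) (a : K) : Prop :=
  φ.denom.eval a ≠ 0 ∧ φ.eval (RingHom.id K) a ∈ V

theorem EvalMem.add {V : ValuationSubring K} {φ ψ : RatFunc K} {a : K}
    (hφ : V.EvalMem φ a) (hψ : V.EvalMem ψ a) : V.EvalMem (φ + ψ) a := by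
  refine ⟨fun h => ?_, ?_⟩
  · have := Polynomial.eval_eq_zero_of_dvd_of_eval_eq_zero (RatFunc.denom_add_dvd φ ψ) h
    rw [Polynomial.eval_mul] at this
    exact (mul_ne_zero hφ.1 hψ.1) this
  · rw [RatFunc.eval_add (RingHom.id K) a hφ.1 hψ.1]
    exact V.add_mem _ _ hφ.2 hψ.2

theorem EvalMem.mul {V : ValuationSubring K} {φ ψ : RatFunc K} {a : K}
    (hφ : V.EvalMem φ a) (hψ : V.EvalMem ψ a) : V.EvalMem (φ * ψ) a := by
  refine ⟨fun h => ?_, ?_⟩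
  · have := Polynomial.eval_eq_zero_of_dvd_of_eval_eq_zero (RatFunc.denom_mul_dvd φ ψ) h
    rw [Polynomial.eval_mul] at this
    exact (mul_ne_zero hφ.1 hψ.1) this
  · rw [RatFunc.eval_mul (RingHom.id K) a hφ.1 hψ.1]
    exact V.mul_mem _ _ hφ.2 hψ.2

theorem evalMem_C {V : ValuationSubring K} {c : K} (hc : c ∈ V) (a : K) :
    V.EvalMem (RatFunc.C c) a := by
  simp [EvalMem, hc]

theorem exists_extension (L : Type*) [Field L] [Algebra K L] :
    ∃ U : ValuationSubring L, ∀ x : K, algebraMap K L x ∈ U ↔ x ∈ V := by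
  obtain ⟨U, hU, hloc⟩ :=
    (LocalSubring.map (algebraMap K L) V.toLocalSubring).exists_le_valuationSubring
  have hmem : ∀ x : K, x ∈ V → algebraMap K L x ∈ U := fun x hx => hU ⟨x, hx, rfl⟩
  refine ⟨U, fun x => ⟨fun hx => ?_, hmem x⟩⟩
  by_contra hxV
  have hx0 : x ≠ 0 := by rintro rfl; exact hxV V.zero_mem
  have hinv : x⁻¹ ∈ V := (V.mem_or_inv_mem x).resolve_left hxV
  have hunit : IsUnit (Subring.inclusion hU ⟨algebraMap K L x⁻¹, x⁻¹, hinv, rfl⟩) :=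
    isUnit_iff_exists_inv.mpr ⟨⟨algebraMap K L x, hx⟩, Subtype.ext (by
      change algebraMap K L x⁻¹ * algebraMap K L x = 1
      rw [← map_mul, inv_mul_cancel₀ hx0, map_one])⟩
  obtain ⟨⟨_, y, hy, rfl⟩, hy'⟩ := isUnit_iff_exists_inv.mp (hloc.1 _ hunit)
  have h1 : algebraMap K L x⁻¹ * algebraMap K L y = 1 := congrArg Subtype.val hy'
  rw [← map_mul, map_eq_one_iff _ (algebraMap K L).injective, inv_mul_eq_one₀ hx0] at h1
  exact hxV (h1 ▸ hy)

variable {V} {s : ℕ → K}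

theorem eval_compare (hs : IsPseudoConvergent V.valuation s) {f g : K[X]}
    (hf : f ≠ 0) (hg : g ≠ 0) :
    (∀ᶠ n in atTop, V.valuation (f.eval (s n)) ≤ V.valuation (g.eval (s n))) ∨
      ∀ᶠ n in atTop, V.valuation (g.eval (s n)) ≤ V.valuation (f.eval (s n)) := by
  let L := AlgebraicClosure K
  obtain ⟨U, hU⟩ := V.exists_extension L
  have heq : V.valuation.IsEquiv (U.valuation.comap (algebraMap K L)) := by
    apply Valuation.isEquiv_of_val_le_one
    intro x
    rw [Valuation.comap_apply, valuation_le_one_iff, valuation_le_one_iff, hU]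
  have hs' : IsPseudoConvergent U.valuation fun n => algebraMap K L (s n) := fun n => by
    simpa using heq.lt_iff_lt.mp (hs n)
  have hinj := Polynomial.map_injective (algebraMap K L) (algebraMap K L).injective
  have hf' : f.map (algebraMap K L) ≠ 0 := fun h => hf (hinj (by simpa using h))
  have hg' : g.map (algebraMap K L) ≠ 0 := fun h => hg (hinj (by simpa using h))
  refine (hs'.val_eval_compare hf' hg').imp ?_ ?_ <;> intro H <;> filter_upwards [H] with n H <;>
  · rw [heq.le_iff_le]
    simpa [Polynomial.eval_map_algebraMap, Polynomial.aeval_algebraMap_apply] using H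

theorem eventually_eval_ne_zero (hs : IsPseudoConvergent V.valuation s) {f : K[X]}
    (hf : f ≠ 0) : ∀ᶠ n in atTop, f.eval (s n) ≠ 0 := by
  have hinj : Function.Injective s := by
    intro m n hmn
    by_contra hne
    wlog h : m < n generalizing m n
    · exact this hmn.symm (Ne.symm hne) (by omega)
    obtain ⟨k, rfl⟩ : ∃ k, n = m + k + 1 := ⟨n - m - 1, by omega⟩
    have h1 := hs.val_sub m k
    have h2 := hs.gauge_pos m
    rw [← h1, ← hmn, sub_self, map_zero] at h2
    exact lt_irrefl _ h2
  have hfin : {n | f.eval (s n) = 0}.Finite :=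
    (Polynomial.finite_setOfPred_isRoot hf).preimage hinj.injOn
  have := hfin.compl_mem_cofinite
  rw [Nat.cofinite_eq_atTop] at this
  exact this

variable (V s)

/-- The valuation domain
`V_E = {φ ∈ K(X) | φ(sₙ) ∈ V for all but finitely many n}`
of a pseudo-convergent sequence `E = {sₙ}`. -/
noncomputable def ofPseudoConvergent (hs : IsPseudoConvergent V.valuation s) :
    ValuationSubring (RatFunc K) where
  carrier := {φ | ∀ᶠ n in atTop, V.EvalMem φ (s n)}
  zero_mem' := Eventually.of_forall fun n => by simp [EvalMem, V.zero_mem]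
  one_mem' := Eventually.of_forall fun n => by simp [EvalMem, V.one_mem]
  add_mem' := by
    intro φ ψ hφ hψ
    filter_upwards [hφ, hψ] with n hφ hψ
    exact hφ.add hψ
  mul_mem' := by
    intro φ ψ hφ hψ
    filter_upwards [hφ, hψ] with n hφ hψ
    exact hφ.mul hψ
  neg_mem' := by
    intro φ hφ
    filter_upwards [hφ] with n hφ
    have h := (evalMem_C (V.neg_mem _ V.one_mem) (s n)).mul hφ
    rwa [map_neg, map_one, neg_one_mul] at h
  mem_or_inv_mem' := by
    intro φ
    rcases eq_or_ne φ 0 with rfl | h0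
    · exact Or.inl (Eventually.of_forall fun n => by simp [EvalMem, V.zero_mem])
    have hd := eventually_eval_ne_zero hs (RatFunc.denom_ne_zero φ)
    have hd' := eventually_eval_ne_zero hs (RatFunc.denom_ne_zero φ⁻¹)
    have hn := eventually_eval_ne_zero hs (RatFunc.num_ne_zero h0)
    refine (eval_compare hs (RatFunc.num_ne_zero h0) (RatFunc.denom_ne_zero φ)).imp ?_ ?_ <;>
      intro H <;> filter_upwards [H, hd, hd', hn] with n H hd hd' hn
    · refine ⟨hd, ?_⟩
      rw [← valuation_le_one_iff, RatFunc.eval, map_div₀]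
      exact div_le_one_of_le₀ (by simpa using H) zero_le
    · refine ⟨hd', ?_⟩
      have hmul := RatFunc.eval_mul (RingHom.id K) (s n) (x := φ) (y := φ⁻¹) hd hd'
      rw [mul_inv_cancel₀ h0, RatFunc.eval_one] at hmul
      rw [eq_inv_of_mul_eq_one_right hmul.symm, ← valuation_le_one_iff, RatFunc.eval, inv_div,
        map_div₀]
      exact div_le_one_of_le₀ (by simpa using H) zero_le

theorem algebraMap_mem_ofPseudoConvergent (hs : IsPseudoConvergent V.valuation s) (d : V) :
    algebraMap V (RatFunc K) d ∈ V.ofPseudoConvergent s hs := by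
  have h : algebraMap V (RatFunc K) d = RatFunc.C (d : K) := rfl
  rw [h]
  exact Eventually.of_forall fun n => evalMem_C d.2 (s n)

/-- `V_E` as a point of the Zariski space `Zar(K(X)|V)`. -/
noncomputable def seqPoint (hs : IsPseudoConvergent V.valuation s) : Zar V (RatFunc K) :=
  ⟨V.ofPseudoConvergent s hs, V.algebraMap_mem_ofPseudoConvergent s hs⟩

/-- The space `𝒱` of all the valuation domains `V_E`, for `E` a pseudo-convergent sequence
in `K`. -/
def seqSpace : Set (Zar V (RatFunc K)) :=
  {W | ∃ (s : ℕ → K) (hs : IsPseudoConvergent V.valuation s), W = V.seqPoint s hs}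

/-- The stratum `𝒱(•, δ)`: the valuation domains `V_E` with `E` of breadth `δ`. -/
def seqStratum [V.valuation.RankOne] (δ : EReal) : Set (Zar V (RatFunc K)) :=
  {W | ∃ (s : ℕ → K) (hs : IsPseudoConvergent V.valuation s),
    HasBreadth V.valuation s δ ∧ W = V.seqPoint s hs}

end ValuationSubring

/-! ### Comparing the two topologies on a subset. -/

namespace Zar

variable {D L : Type*} [CommRing D] [Field L] [Algebra D L]

/-! Coincidence on a subset `Y` means that every `W ∈ Y` with `φ ∉ W` has a Zariski neighbourhood in
`Y` whose members all omit `φ` (`topologiesCoincideOn_iff`). The implications 2 → 3 → 4 are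
restrictions to smaller subsets; the content is 1 → 2 and 4 → 1. Values are written multiplicatively
throughout.

1 → 2 (`exists_finite_conditions`): let `φ = f/g`. Close to `E` but away from its pseudo-limits,
`|f|` and `|g|` are monomials in the distance to `E` (`val_eval_near`). So `|g| < |f|` can be forced
by confining `x` to a ball, except when `E` has a pseudo-limit `a ∈ K`, where `x` must also be kept
far enough from `a`. This is a strict condition `|y(x)| > 1`, whereas Zariski neighbourhoods provide
only non-strict ones. If the residue field has `q` elements, `1 ≤ |y^q - y|` is a non-strict
condition that implies it.

4 → 1 (`finite_residueField_of_topologiesCoincideOn`): non-discreteness provides `|e n| ↓ 1`. The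
domain of `c * e n` omits `X/c`, but a condition valid along this sequence also holds at `c * x` for
`x ∈ V` outside finitely many residue classes (`exists_residue_polynomial`). If the residue field is
infinite, a sequence inside one remaining class gives a domain in any prescribed Zariski
neighbourhood that contains `X/c`. -/

theorem basicSetFinset_eq_iInter (S : Finset L) :
    basicSetFinset D S = ⋂ φ ∈ S, basicSet D φ := by
  ext W
  simp [basicSetFinset, basicSet]

theorem isOpen_basicSetFinset (S : Finset L) :
    IsOpen[zariskiTopology D L] (basicSetFinset D S) := by
  let _ := zariskiTopology D L
  rw [basicSetFinset_eq_iInter]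
  exact isOpen_biInter_finset fun φ _ =>
    TopologicalSpace.isOpen_generateFrom_of_mem (Set.mem_range_self φ)

theorem isOpen_constructible_compl_basicSet (φ : L) :
    IsOpen[constructibleTopology D L] (basicSet D φ)ᶜ :=
  TopologicalSpace.isOpen_generateFrom_of_mem
    ⟨{φ}, Or.inr (by simp [basicSetFinset_eq_iInter])⟩

theorem exists_basicSetFinset_subset {U : Set (Zar D L)} (hU : IsOpen[zariskiTopology D L] U)
    {W : Zar D L} (hW : W ∈ U) :
    ∃ S : Finset L, W ∈ basicSetFinset D S ∧ basicSetFinset D S ⊆ U := by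
  classical
  induction hU with
  | basic s hs =>
    obtain ⟨φ, rfl⟩ := hs
    exact ⟨{φ}, by simpa [basicSetFinset_eq_iInter] using hW, by simp [basicSetFinset_eq_iInter]⟩
  | univ => exact ⟨∅, by simp [basicSetFinset_eq_iInter], Set.subset_univ _⟩
  | inter s t _ _ ihs iht =>
    obtain ⟨S, hS, hSs⟩ := ihs hW.1
    obtain ⟨T, hT, hTt⟩ := iht hW.2
    refine ⟨S ∪ T, fun φ hφ => ?_, fun W' h' => ⟨hSs fun φ hφ => ?_, hTt fun φ hφ => ?_⟩⟩
    · exact (Finset.mem_union.mp hφ).elim (hS φ) (hT φ)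
    · exact h' φ (Finset.mem_union_left _ hφ)
    · exact h' φ (Finset.mem_union_right _ hφ)
  | sUnion 𝒮 _ ih =>
    obtain ⟨s, hs, hWs⟩ := hW
    obtain ⟨S, hS, hSs⟩ := ih s hs hWs
    exact ⟨S, hS, hSs.trans (Set.subset_sUnion_of_mem hs)⟩

theorem TopologiesCoincideOn.mono {Y Z : Set (Zar D L)} (h : TopologiesCoincideOn Z)
    (hYZ : Y ⊆ Z) : TopologiesCoincideOn Y := by
  have := congrArg (TopologicalSpace.induced (Set.inclusion hYZ)) h
  rwa [induced_compose, induced_compose] at this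

/-- The constructible topology is finer, and only the complements of finite intersections of basic
sets are new. Each is a union of complements of single sets `B(φ)`, so testing one `φ` at a time is
enough. -/
theorem topologiesCoincideOn_iff {Y : Set (Zar D L)} :
    TopologiesCoincideOn Y ↔ ∀ W ∈ Y, ∀ φ : L, φ ∉ W.1 →
      ∃ S : Finset L, W ∈ basicSetFinset D S ∧ ∀ W' ∈ Y, W' ∈ basicSetFinset D S → φ ∉ W'.1 := by
  constructor
  · intro h W hW φ hφ
    have hopen : IsOpen[TopologicalSpace.induced (Subtype.val : Y → Zar D L)
        (zariskiTopology D L)] (Subtype.val ⁻¹' (basicSet D φ)ᶜ) := by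
      rw [show TopologicalSpace.induced (Subtype.val : Y → Zar D L) (zariskiTopology D L) = _
        from h]
      exact @isOpen_induced _ _ (constructibleTopology D L) _ _
        (isOpen_constructible_compl_basicSet φ)
    obtain ⟨U, hU, hUY⟩ :=
      (@isOpen_induced_iff _ _ (zariskiTopology D L) _ _).mp hopen
    have hmem : ∀ x : Y, x.1 ∈ U ↔ x.1 ∈ (basicSet D φ)ᶜ := fun x => by
      simpa using Set.ext_iff.mp hUY x
    obtain ⟨S, hS, hSU⟩ := exists_basicSetFinset_subset hU ((hmem ⟨W, hW⟩).mpr hφ)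
    exact ⟨S, hS, fun W' hW' hS' => (hmem ⟨W', hW'⟩).mp (hSU hS')⟩
  · intro h
    refine le_antisymm ?_ (induced_mono (le_generateFrom ?_))
    · conv_rhs => rw [constructibleTopology, induced_generateFrom_eq]
      refine le_generateFrom ?_
      rintro _ ⟨_, ⟨S, rfl | rfl⟩, rfl⟩
      · exact @isOpen_induced _ _ (zariskiTopology D L) _ _ (isOpen_basicSetFinset S)
      · let _ := TopologicalSpace.induced (Subtype.val : Y → Zar D L) (zariskiTopology D L)
        refine isOpen_iff_forall_mem_open.mpr fun W hW => ?_
        obtain ⟨φ, hφS, hφ⟩ : ∃ φ ∈ S, φ ∉ W.1.1 := by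
          simpa [basicSetFinset] using hW
        obtain ⟨T, hT, hTφ⟩ := h W.1 W.2 φ hφ
        exact ⟨Subtype.val ⁻¹' basicSetFinset D T,
          fun W' hW' hS => hTφ W'.1 W'.2 hW' (hS φ hφS),
          @isOpen_induced _ _ (zariskiTopology D L) _ _ (isOpen_basicSetFinset T), hT⟩
    · rintro _ ⟨φ, rfl⟩
      exact TopologicalSpace.isOpen_generateFrom_of_mem
        ⟨{φ}, Or.inl (by simp [basicSetFinset_eq_iInter])⟩

end Zar

/-! ### Membership in `V_E` through arbitrary fractions. -/

namespace ValuationSubring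

open Filter

variable {K : Type*} [Field K] {V : ValuationSubring K} {s : ℕ → K}

/-- The definition evaluates the reduced fraction. Any other representation has the same value
wherever both denominators are nonzero, hence at almost all terms. -/
theorem div_mem_ofPseudoConvergent_iff (hs : IsPseudoConvergent V.valuation s) (f : K[X])
    {g : K[X]} (hg : g ≠ 0) :
    algebraMap K[X] (RatFunc K) f / algebraMap K[X] (RatFunc K) g ∈ V.ofPseudoConvergent s hs ↔
      ∀ᶠ n in atTop, V.valuation (f.eval (s n)) ≤ V.valuation (g.eval (s n)) := by
  set φ := algebraMap K[X] (RatFunc K) f / algebraMap K[X] (RatFunc K) g with hφ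
  change (∀ᶠ n in atTop, V.EvalMem φ (s n)) ↔ _
  refine eventually_congr ?_
  filter_upwards [eventually_eval_ne_zero hs φ.denom_ne_zero, eventually_eval_ne_zero hs hg]
    with n hd hgn
  have hcross : φ.num * g = f * φ.denom := by
    apply RatFunc.algebraMap_injective K
    have hg' : algebraMap K[X] (RatFunc K) g ≠ 0 := RatFunc.algebraMap_ne_zero hg
    have hd' : algebraMap K[X] (RatFunc K) φ.denom ≠ 0 :=
      RatFunc.algebraMap_ne_zero φ.denom_ne_zero
    have := φ.num_div_denom
    rw [map_mul, map_mul, ← div_eq_div_iff hd' hg', this]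
  have heval : φ.eval (RingHom.id K) (s n) = f.eval (s n) / g.eval (s n) := by
    have := congrArg (Polynomial.eval (s n)) hcross
    rw [Polynomial.eval_mul, Polynomial.eval_mul] at this
    rw [RatFunc.eval, Polynomial.eval₂_id, Polynomial.eval₂_id, div_eq_div_iff hd hgn, this]
  rw [EvalMem, heval, ← valuation_le_one_iff, map_div₀,
    div_le_one₀ (zero_lt_iff.mpr (by simpa using hgn))]
  exact and_iff_right hd

end ValuationSubring

/-! ### Polynomial values near a pseudo-convergent sequence. -/

namespace IsPseudoConvergent

open Filter Polynomial

section

variable {L Γ : Type*} [Field L] [LinearOrderedCommGroupWithZero Γ] {u : Valuation L Γ} {s : ℕ → L}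

theorem val_sub_of_lt (hs : IsPseudoConvergent u s) {n m : ℕ} (h : n < m) :
    u (s m - s n) = u (s (n + 1) - s n) := by
  obtain ⟨k, rfl⟩ : ∃ k, m = n + k + 1 := ⟨m - n - 1, by omega⟩
  exact hs.val_sub n k

theorem val_sub_le (hs : IsPseudoConvergent u s) {n m : ℕ} (h : n ≤ m) :
    u (s m - s n) ≤ u (s (n + 1) - s n) := by
  rcases h.eq_or_lt with rfl | h
  · simp
  · exact (hs.val_sub_of_lt h).le

/-- Once `x` is seen not to be a pseudo-limit, later terms move too little to change its distance.
-/
theorem val_sub_eq_of_lt_val_sub (hs : IsPseudoConvergent u s) {n m : ℕ} (h : n ≤ m) {x : L}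
    (hx : u (s (n + 1) - s n) < u (x - s n)) : u (x - s m) = u (x - s n) := by
  rw [show x - s m = (x - s n) - (s m - s n) by ring]
  exact u.map_sub_eq_of_lt_left ((hs.val_sub_le h).trans_lt hx)

/-- Near a pseudo-convergent sequence, but away from its pseudo-limits, the value of a polynomial
at `x` is a monomial in the distance of `x` from the tail of the sequence. -/
theorem val_eval_near [IsAlgClosed L] (hs : IsPseudoConvergent u s) (f : L[X]) (hf : f ≠ 0) :
    ∃ c : Γ, c ≠ 0 ∧ ∃ k : ℕ, ∀ᶠ N in atTop, ∀ m ≥ N, ∀ x,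
      u (x - s N) ≤ u (s (N + 1) - s N) → u (s (m + 1) - s m) < u (x - s m) →
        u (f.eval x) = c * u (x - s m) ^ k := by
  have key : ∀ R : Multiset L, ∃ c : Γ, c ≠ 0 ∧ ∃ k : ℕ, ∀ᶠ N in atTop, ∀ m ≥ N, ∀ x,
      u (x - s N) ≤ u (s (N + 1) - s N) → u (s (m + 1) - s m) < u (x - s m) →
        u (((R.map fun a => X - C a).prod).eval x) = c * u (x - s m) ^ k := by
    intro R
    induction R using Multiset.induction_on with
    | empty => exact ⟨1, one_ne_zero, 0, by simp⟩
    | cons a R ih =>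
      obtain ⟨c, hc, k, h⟩ := ih
      -- A root that is not a pseudo-limit contributes a constant factor; a pseudo-limit root
      -- contributes one factor `u (x - s m)`.
      by_cases ha : ∃ M, u (s (M + 1) - s M) < u (a - s M)
      · obtain ⟨M, hM⟩ := ha
        refine ⟨u (a - s M) * c, mul_ne_zero (zero_le.trans_lt hM).ne' hc, k, ?_⟩
        filter_upwards [h, eventually_ge_atTop M] with N hN hMN m hm x hx hxm
        have hxa : u (x - a) = u (a - s M) := by
          rw [show x - a = (x - s N) - (a - s N) by ring, u.map_sub_eq_of_lt_right,
            hs.val_sub_eq_of_lt_val_sub hMN hM]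
          rw [hs.val_sub_eq_of_lt_val_sub hMN hM]
          exact (hx.trans (hs.gauge_strictAnti.antitone hMN)).trans_lt hM
        rw [Multiset.map_cons, Multiset.prod_cons, eval_mul, map_mul, hN m hm x hx hxm, eval_sub,
          eval_X, eval_C, hxa, mul_assoc]
      · push Not at ha
        refine ⟨c, hc, k + 1, ?_⟩
        filter_upwards [h] with N hN m hm x hx hxm
        have hxa : u (x - a) = u (x - s m) := by
          rw [show x - a = (x - s m) - (a - s m) by ring]
          exact u.map_sub_eq_of_lt_left ((ha m).trans_lt hxm)
        rw [Multiset.map_cons, Multiset.prod_cons, eval_mul, map_mul, hN m hm x hx hxm, eval_sub,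
          eval_X, eval_C, hxa, pow_succ, mul_left_comm, mul_comm (u _)]
  obtain ⟨c, hc, k, h⟩ := key f.roots
  refine ⟨u f.leadingCoeff * c, mul_ne_zero (by simpa using hf) hc, k, ?_⟩
  filter_upwards [h] with N hN m hm x hx hxm
  conv_lhs => rw [(IsAlgClosed.splits f).eq_prod_roots]
  rw [eval_mul, eval_C, map_mul, hN m hm x hx hxm, mul_assoc]

end

variable {K L Γ : Type*} [Field K] [Field L] [Algebra K L] [LinearOrderedCommGroupWithZero Γ]
  {u : Valuation L Γ} {w : Valuation K Γ} {s : ℕ → K}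

theorem val_eval_near_of_comap [IsAlgClosed L] (hw : ∀ x, w x = u (algebraMap K L x))
    (hs : IsPseudoConvergent w s) (f : K[X]) (hf : f ≠ 0) :
    ∃ c : Γ, c ≠ 0 ∧ ∃ k : ℕ, ∀ᶠ N in atTop, ∀ m ≥ N, ∀ x,
      w (x - s N) ≤ w (s (N + 1) - s N) → w (s (m + 1) - s m) < w (x - s m) →
        w (f.eval x) = c * w (x - s m) ^ k := by
  have hs' : IsPseudoConvergent u fun n => algebraMap K L (s n) := fun n => by
    simpa only [← map_sub, ← hw] using hs n
  obtain ⟨c, hc, k, h⟩ := hs'.val_eval_near (f.map (algebraMap K L))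
    ((Polynomial.map_ne_zero_iff (algebraMap K L).injective).mpr hf)
  refine ⟨c, hc, k, ?_⟩
  filter_upwards [h] with N hN m hm x hx hxm
  have := hN m hm (algebraMap K L x)
  simp only [← map_sub, ← hw, Polynomial.eval_map_algebraMap,
    Polynomial.aeval_algebraMap_apply] at this
  rw [← this hx hxm, Polynomial.coe_aeval_eq_eval]

/-- Suppose that `y ^ q - y` lies in the maximal ideal for every integer `y` of `w`. If `w g < w f`
holds along a pseudo-convergent sequence, then it is implied by finitely many conditions `w p ≤ w r`
which also hold along the sequence. -/
theorem exists_finite_conditions [IsAlgClosed L] (hw : ∀ x, w x = u (algebraMap K L x))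
    (hs : IsPseudoConvergent w s) {q : ℕ} (hq : 1 < q)
    (hqw : ∀ y, w y ≤ 1 → w (y ^ q - y) < 1) {f g : K[X]} (hf : f ≠ 0) (hg : g ≠ 0)
    (hfg : ∃ᶠ n in atTop, w (g.eval (s n)) < w (f.eval (s n))) :
    ∃ T : Finset (K[X] × K[X]),
      (∀ p ∈ T, p.2 ≠ 0 ∧ ∀ᶠ n in atTop, w (p.1.eval (s n)) ≤ w (p.2.eval (s n))) ∧
      ∀ x, f.eval x ≠ 0 → (∀ p ∈ T, p.2.eval x ≠ 0 ∧ w (p.1.eval x) ≤ w (p.2.eval x)) →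
        w (g.eval x) < w (f.eval x) := by
  classical
  obtain ⟨A, hA, i, hfA⟩ := val_eval_near_of_comap hw hs f hf
  obtain ⟨B, hB, j, hgB⟩ := val_eval_near_of_comap hw hs g hg
  obtain ⟨N, hN, hfN, hgN⟩ := (hfg.and_eventually (hfA.and hgB)).exists
  set d : ℕ → Γ := fun n => w (s (n + 1) - s n) with hd
  have hanti : StrictAnti d := hs.gauge_strictAnti
  have hdpos : ∀ n, 0 < d n := hs.gauge_pos
  have hApos : 0 < A := zero_lt_iff.mpr hA
  have hBpos : 0 < B := zero_lt_iff.mpr hB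
  have hnext : ∀ n, w (s n - s (n + 1)) = d n := fun n => w.map_sub_swap _ _
  have hself : ∀ n, d (n + 1) < w (s n - s (n + 1)) := fun n => by
    rw [hnext]; exact hanti n.lt_succ_self
  -- Seen from index `n + 1`, the term `s n` is itself a point away from the pseudo-limits, at
  -- distance `d n`.
  have hfs : ∀ n ≥ N, w (f.eval (s n)) = A * d n ^ i := fun n hn => by
    rw [hfN (n + 1) (by omega) (s n) (hs.val_sub_le hn) (hself n), hnext]
  have hgs : ∀ n ≥ N, w (g.eval (s n)) = B * d n ^ j := fun n hn => by
    rw [hgN (n + 1) (by omega) (s n) (hs.val_sub_le hn) (hself n), hnext]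
  rw [hfs N le_rfl, hgs N le_rfl] at hN
  -- comparison at a point at distance `ρ` from the tail of the sequence
  have hcmp_ge : ∀ k, j = i + k → ∀ ρ, 0 < ρ → (B * ρ ^ j < A * ρ ^ i ↔ B * ρ ^ k < A) := by
    rintro k rfl ρ hρ
    rw [pow_add, mul_left_comm, mul_comm A, mul_lt_mul_iff_right₀ (pow_pos hρ _)]
  have hcmp_le : ∀ k, i = j + k → ∀ ρ, 0 < ρ → (B * ρ ^ j < A * ρ ^ i ↔ B < A * ρ ^ k) := by
    rintro k rfl ρ hρ
    rw [pow_add, mul_left_comm, mul_comm B, mul_lt_mul_iff_right₀ (pow_pos hρ _)]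
  have hlarge : ∀ k, i = j + k → ∀ n, B < A * d n ^ k := by
    intro k hk n
    obtain ⟨m, hm, hmn⟩ := (hfg.and_eventually (eventually_ge_atTop (max n N))).exists
    rw [hfs m (le_of_max_le_right hmn), hgs m (le_of_max_le_right hmn),
      hcmp_le k hk _ (hdpos m)] at hm
    exact hm.trans_le (mul_le_mul_right (pow_le_pow_left' (hanti.antitone
      (le_of_max_le_left hmn)) k) A)
  -- If a constant of value below `1` separates `g` from `f`, a single non-strict condition gives
  -- the strict inequality.
  by_cases hgap : ∃ e : K, e ≠ 0 ∧ w e < 1 ∧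
      ∀ᶠ n in atTop, w (g.eval (s n)) ≤ w ((C e * f).eval (s n))
  · obtain ⟨e, he0, he1, he⟩ := hgap
    refine ⟨{(g, C e * f)}, ?_, ?_⟩
    · simpa using ⟨⟨he0, hf⟩, by simpa using he⟩
    · intro x hfx hx
      have := (hx _ (Finset.mem_singleton_self _)).2
      refine this.trans_lt ?_
      rw [eval_mul, eval_C, map_mul]
      exact mul_lt_of_lt_one_left (zero_lt_iff.mpr (by simpa using hfx)) he1
  -- Without pseudo-limits in `K`, the ball of radius `d N` suffices: the monomial formulas apply at
  -- all of its points.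
  by_cases hlim : ∀ x, ∃ m, d m < w (x - s m)
  · have hne : s (N + 1) - s N ≠ 0 := fun h => (hdpos N).ne' (by simp [hd, h])
    refine ⟨{(X - C (s N), C (s (N + 1) - s N))}, ?_, ?_⟩
    · rintro p hp
      obtain rfl := Finset.mem_singleton.mp hp
      refine ⟨C_ne_zero.mpr hne, ?_⟩
      filter_upwards [eventually_ge_atTop N] with n hn
      simpa using hs.val_sub_le hn
    · intro x hfx hx
      have hxN : w (x - s N) ≤ d N := by simpa using (hx _ (Finset.mem_singleton_self _)).2
      obtain ⟨M, hM⟩ := hlim x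
      obtain ⟨m, hmN, hm⟩ : ∃ m ≥ N, d m < w (x - s m) := by
        refine ⟨max M N, le_max_right _ _, ?_⟩
        rw [hs.val_sub_eq_of_lt_val_sub (le_max_left _ _) hM]
        exact (hanti.antitone (le_max_left _ _)).trans_lt hM
      have hpos : 0 < w (x - s m) := zero_le.trans_lt hm
      rw [hfN m hmN x hxN hm, hgN m hmN x hxN hm]
      rcases le_total i j with hij | hij
      · obtain ⟨k, hk⟩ := Nat.exists_eq_add_of_le hij
        have hρ : w (x - s m) ≤ d N := by
          rw [show x - s m = (x - s N) - (s m - s N) by ring]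
          exact (w.map_sub _ _).trans (max_le hxN (hs.val_sub_le hmN))
        rw [hcmp_ge k hk _ hpos]
        rw [hcmp_ge k hk _ (hdpos N)] at hN
        exact (mul_le_mul_right (pow_le_pow_left' hρ k) B).trans_lt hN
      · obtain ⟨k, hk⟩ := Nat.exists_eq_add_of_le hij
        rw [hcmp_le k hk _ hpos]
        exact (hlarge k hk m).trans_le (mul_le_mul_right (pow_le_pow_left' hm.le k) A)
  push Not at hlim
  obtain ⟨a, ha⟩ := hlim
  have hsa : ∀ n, w (s n - a) = d n := fun n => by
    rw [show s n - a = (s n - s (n + 1)) - (a - s (n + 1)) by ring, w.map_sub_eq_of_lt_left,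
      hnext]
    rw [hnext]
    exact (ha (n + 1)).trans_lt (hanti n.lt_succ_self)
  have hf0 : f.eval (s N) ≠ 0 := by
    rw [← w.ne_zero_iff, hfs N le_rfl]; exact mul_ne_zero hA (pow_ne_zero _ (hdpos N).ne')
  have hg0 : g.eval (s N) ≠ 0 := by
    rw [← w.ne_zero_iff, hgs N le_rfl]; exact mul_ne_zero hB (pow_ne_zero _ (hdpos N).ne')
  -- If `i ≤ j`, then `|g/f|` does not increase along the sequence, so its value at `s N` would give
  -- a separating constant.
  have hji : j < i := by
    by_contra! hij
    obtain ⟨k, hk⟩ := Nat.exists_eq_add_of_le hij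
    refine hgap ⟨g.eval (s N) / f.eval (s N), div_ne_zero hg0 hf0, ?_, ?_⟩
    · rw [map_div₀, hfs N le_rfl, hgs N le_rfl]
      exact (div_lt_one₀ (zero_le.trans_lt hN)).mpr hN
    · filter_upwards [eventually_ge_atTop N] with n hn
      have hdn := pow_pos (hdpos N) i
      rw [eval_mul, eval_C, map_mul, map_div₀, hfs N le_rfl, hgs N le_rfl, hfs n hn, hgs n hn,
        div_mul_eq_mul_div, le_div_iff₀ (mul_pos hApos hdn), hk, pow_add, pow_add]
      calc B * (d n ^ i * d n ^ k) * (A * d N ^ i)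
          = (B * d N ^ i * (A * d n ^ i)) * d n ^ k := by ac_rfl
        _ ≤ (B * d N ^ i * (A * d n ^ i)) * d N ^ k :=
          mul_le_mul_right (pow_le_pow_left' (hanti.antitone hn) k) _
        _ = B * (d N ^ i * d N ^ k) * (A * d n ^ i) := by ac_rfl
  obtain ⟨k, hk⟩ := Nat.exists_eq_add_of_le hji.le
  have hNa : s N - a ≠ 0 := fun h => (hdpos N).ne' (by rw [← hsa, h, map_zero])
  -- The scaling of `b` makes `y = b (X - a)^k` satisfy `|y| = |f/g|` wherever both monomial
  -- formulas hold.
  obtain ⟨b, hb⟩ : ∃ b : K, w b = A / B := by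
    refine ⟨f.eval (s N) / g.eval (s N) / (s N - a) ^ k, ?_⟩
    rw [map_div₀, map_div₀, map_pow, hfs N le_rfl, hgs N le_rfl, hsa, hk, pow_add]
    have := (pow_pos (hdpos N) j).ne'
    have := (pow_pos (hdpos N) k).ne'
    field_simp
  have hbk : ∀ ρ, w b * ρ ^ k = A * ρ ^ k / B := fun ρ => by rw [hb, div_mul_eq_mul_div]
  set y : K[X] := C b * (X - C a) ^ k with hy
  have hyx : ∀ x, w (y.eval x) = A * w (x - a) ^ k / B := fun x => by simp [hy, hbk]
  have hys : ∀ n, 1 < w (y.eval (s n)) := fun n => by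
    rw [hyx, hsa, one_lt_div₀ hBpos]
    exact hlarge k hk n
  have hyq : ∀ n, 1 ≤ w ((y ^ q - y).eval (s n)) := fun n => by
    rw [eval_sub, eval_pow, w.map_sub_eq_of_lt_left]
    · rw [map_pow]
      exact one_le_pow₀ (hys n).le
    · rw [map_pow]
      exact lt_self_pow₀ (hys n) hq
  refine ⟨{(X - C a, C (s N - a)), (1, y ^ q - y)}, ?_, ?_⟩
  · rintro p hp
    rcases Finset.mem_insert.mp hp with rfl | hp
    · refine ⟨C_ne_zero.mpr hNa, ?_⟩
      filter_upwards [eventually_ge_atTop N] with n hn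
      simpa [hsa] using hanti.antitone hn
    · obtain rfl := Finset.mem_singleton.mp hp
      refine ⟨fun h => ?_, Eventually.of_forall fun n => by simpa using hyq n⟩
      have := hyq N
      simp only at h
      rw [h] at this
      simp at this
  · intro x hfx hx
    have hxa : w (x - a) ≤ d N := by
      simpa only [eval_sub, eval_X, eval_C, hsa] using
        (hx (X - C a, C (s N - a)) (Finset.mem_insert_self _ _)).2
    -- This is where `hqw` enters: `|y x| ≤ 1` would force `|y^q - y| < 1` at `x`.
    have hyx1 : 1 < w (y.eval x) := by
      by_contra! h
      have h1 := hqw _ h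
      have h2 := (hx (1, y ^ q - y) (by simp)).2
      simp only [eval_one, map_one, eval_sub, eval_pow] at h2
      exact h2.not_gt h1
    have hyx2 : B < A * w (x - a) ^ k := by rwa [hyx, one_lt_div₀ hBpos] at hyx1
    -- Were `x` within every `d m` of `a`, then `(y x)⁻¹` would be a separating constant, against
    -- `hgap`.
    have hfar : ∃ m, d m < w (x - a) := by
      by_contra! hnear
      refine hgap ⟨(y.eval x)⁻¹, ?_, ?_, ?_⟩
      · rw [← w.ne_zero_iff, map_inv₀]
        exact inv_ne_zero (zero_lt_one.trans hyx1).ne'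
      · rw [map_inv₀]
        exact inv_lt_one_of_one_lt₀ hyx1
      · filter_upwards [eventually_ge_atTop N] with n hn
        have hxpos : 0 < A * w (x - a) ^ k := hBpos.trans hyx2
        rw [eval_mul, eval_C, map_mul, map_inv₀, hyx, inv_div, hfs n hn, hgs n hn,
          div_mul_eq_mul_div, le_div_iff₀ hxpos, hk, pow_add]
        calc B * d n ^ j * (A * w (x - a) ^ k)
            = B * (A * d n ^ j) * w (x - a) ^ k := by ac_rfl
          _ ≤ B * (A * d n ^ j) * d n ^ k := mul_le_mul_right (pow_le_pow_left' (hnear n) k) _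
          _ = B * (A * (d n ^ j * d n ^ k)) := by ac_rfl
    obtain ⟨M, hM⟩ := hfar
    set m := max M N with hm
    have hdm : d m < w (x - a) := (hanti.antitone (le_max_left _ _)).trans_lt hM
    have hxm : w (x - s m) = w (x - a) := by
      rw [show x - s m = (x - a) - (s m - a) by ring]
      exact w.map_sub_eq_of_lt_left (by rwa [hsa])
    have hxN : w (x - s N) ≤ d N := by
      rw [show x - s N = (x - a) - (s N - a) by ring]
      exact (w.map_sub _ _).trans (max_le hxa (hsa N).le)
    rw [hfN m (le_max_right _ _) x hxN (by rwa [hxm]), hgN m (le_max_right _ _) x hxN (by rwa [hxm]),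
      hxm, hcmp_le k hk _ (zero_le.trans_lt hdm)]
    exact hyx2

end IsPseudoConvergent

/-! ### Finite residue field: the topologies coincide. -/

namespace ValuationSubring

open Filter

variable {K : Type*} [Field K] (V : ValuationSubring K)

theorem valuation_pow_card_sub_lt_one [Finite (IsLocalRing.ResidueField V)] {y : K}
    (hy : V.valuation y ≤ 1) :
    V.valuation (y ^ Nat.card (IsLocalRing.ResidueField V) - y) < 1 := by
  have := Fintype.ofFinite (IsLocalRing.ResidueField V)
  rw [Nat.card_eq_fintype_card]
  lift y to V using (V.valuation_le_one_iff y).mp hy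
  refine (V.valuation_lt_one_iff (y ^ Fintype.card (IsLocalRing.ResidueField V) - y)).mp ?_
  rw [← IsLocalRing.residue_eq_zero_iff, map_sub, map_pow, FiniteField.pow_card, sub_self]

theorem topologiesCoincideOn_seqSpace [Finite (IsLocalRing.ResidueField V)] :
    Zar.TopologiesCoincideOn V.seqSpace := by
  classical
  rw [Zar.topologiesCoincideOn_iff]
  rintro _ ⟨s, hs, rfl⟩ φ hφ
  obtain ⟨U, hU⟩ := V.exists_extension (AlgebraicClosure K)
  set w := U.valuation.comap (algebraMap K (AlgebraicClosure K)) with hw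
  have heq : V.valuation.IsEquiv w := by
    apply Valuation.isEquiv_of_val_le_one
    intro x
    rw [hw, Valuation.comap_apply, valuation_le_one_iff, valuation_le_one_iff, hU]
  replace hφ : φ ∉ V.ofPseudoConvergent s hs := hφ
  rw [← φ.num_div_denom, div_mem_ofPseudoConvergent_iff hs _ φ.denom_ne_zero,
    not_eventually] at hφ
  have hnum : φ.num ≠ 0 := by
    rintro h
    obtain ⟨n, hn⟩ := hφ.exists
    exact hn (by simp [h])
  obtain ⟨T, hT, hTx⟩ := IsPseudoConvergent.exists_finite_conditions (u := U.valuation) (w := w) (fun x => rfl)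
    (fun n => heq.lt_iff_lt.mp (hs n)) (q := Nat.card (IsLocalRing.ResidueField V))
    Finite.one_lt_card
    (fun y hy => heq.lt_one_iff_lt_one.mp
      (V.valuation_pow_card_sub_lt_one (heq.le_one_iff_le_one.mpr hy)))
    hnum φ.denom_ne_zero (hφ.mono fun n hn => heq.lt_iff_lt.mp (not_le.mp hn))
  refine ⟨T.image fun p => algebraMap K[X] (RatFunc K) p.1 / algebraMap K[X] (RatFunc K) p.2,
    ?_, ?_⟩
  · intro ψ hψ
    obtain ⟨p, hp, rfl⟩ := Finset.mem_image.mp hψ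
    exact (div_mem_ofPseudoConvergent_iff hs _ (hT p hp).1).mpr
      ((hT p hp).2.mono fun n hn => heq.le_iff_le.mpr hn)
  · rintro _ ⟨s', hs', rfl⟩ hmem hφ'
    replace hφ' : φ ∈ V.ofPseudoConvergent s' hs' := hφ'
    rw [← φ.num_div_denom, div_mem_ofPseudoConvergent_iff hs' _ φ.denom_ne_zero] at hφ'
    have hall : ∀ᶠ n in atTop, ∀ p ∈ T, p.2.eval (s' n) ≠ 0 ∧
        w (p.1.eval (s' n)) ≤ w (p.2.eval (s' n)) := by
      refine (Filter.eventually_all_finset T).mpr fun p hp => ?_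
      have := (div_mem_ofPseudoConvergent_iff hs' _ (hT p hp).1).mp
        (hmem _ (Finset.mem_image_of_mem _ hp))
      filter_upwards [this, eventually_eval_ne_zero hs' (hT p hp).1] with n h1 h2
      exact ⟨h2, heq.le_iff_le.mp h1⟩
    -- The finite conditions act pointwise, so one sufficiently late term of `s'` gives the
    -- contradiction.
    obtain ⟨n, h1, h2, h3⟩ := (hφ'.and (hall.and (eventually_eval_ne_zero hs' hnum))).exists
    exact (heq.le_iff_le.mp h1).not_gt (hTx _ h3 h2)

end ValuationSubring

/-! ### Real values of a rank one valuation and non-discreteness. -/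

namespace ValuationSubring

open Filter Polynomial

variable {K : Type*} [Field K] (V : ValuationSubring K) [V.valuation.RankOne]

/-- The rank one valuation with valuation ring `V`, as an absolute value in `ℝ≥0`. -/
noncomputable def nnVal : Valuation K ℝ≥0 :=
  V.valuation.restrict.map (Valuation.RankOne.hom V.valuation)
    (Valuation.RankOne.strictMono V.valuation).monotone

theorem addVal_eq (x : K) : addVal V.valuation x = -ENNReal.log (V.nnVal x : ℝ≥0∞) := rfl

variable {V}

theorem nnVal_lt_iff {x y : K} : V.nnVal x < V.nnVal y ↔ V.valuation x < V.valuation y :=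
  (Valuation.RankOne.strictMono V.valuation).lt_iff_lt.trans V.valuation.restrict_lt_iff

theorem nnVal_le_iff {x y : K} : V.nnVal x ≤ V.nnVal y ↔ V.valuation x ≤ V.valuation y :=
  (Valuation.RankOne.strictMono V.valuation).le_iff_le.trans V.valuation.restrict_le_iff

theorem nnVal_le_one_iff {x : K} : V.nnVal x ≤ 1 ↔ x ∈ V := by
  rw [← V.valuation_le_one_iff, ← map_one V.nnVal, nnVal_le_iff, map_one]

theorem nnVal_lt_one_iff (x : V) : V.nnVal x < 1 ↔ IsLocalRing.residue V x = 0 := by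
  rw [IsLocalRing.residue_eq_zero_iff, V.valuation_lt_one_iff, ← map_one V.nnVal, nnVal_lt_iff,
    map_one]

theorem exists_nnVal_lt {γ : ℝ≥0} (hγ : γ ≠ 0) : ∃ x, x ≠ 0 ∧ V.nnVal x < γ :=
  Valuation.RankOne.exists_val_lt V.valuation hγ

theorem isUnit_of_nnVal_eq_one (x : V) (hx : V.nnVal x = 1) : IsUnit x := by
  by_contra h
  exact ((nnVal_lt_one_iff x).mpr ((IsLocalRing.residue_eq_zero_iff x).mpr h)).ne hx

/-- Dividing `x` by the power of `ϖ` with `|ϖ|^(n+1) < |x| ≤ |ϖ|^n` leaves a value in `(|ϖ|, 1]`,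
which maximality forces to be `1`. -/
theorem isDiscreteValuationRing_of_nnVal_le {ϖ : K} (h0 : ϖ ≠ 0) (h1 : V.nnVal ϖ < 1)
    (hmax : ∀ x, V.nnVal x < 1 → V.nnVal x ≤ V.nnVal ϖ) : IsDiscreteValuationRing V := by
  have hpos : 0 < V.nnVal ϖ := V.nnVal.pos_iff.mpr h0
  have hlt : ∀ x : V, ¬ IsUnit x → V.nnVal x < 1 := fun x hx =>
    (nnVal_le_one_iff.mpr x.2).lt_of_ne fun h => hx (isUnit_of_nnVal_eq_one x h)
  apply IsDiscreteValuationRing.ofHasUnitMulPowIrreducibleFactorization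
  refine ⟨⟨ϖ, nnVal_le_one_iff.mp h1.le⟩, ⟨fun h => ?_, fun a b hab => ?_⟩, fun {x} hx => ?_⟩
  · rw [← IsLocalRing.notMem_maximalIdeal, ← IsLocalRing.residue_eq_zero_iff,
      ← nnVal_lt_one_iff] at h
    exact h h1
  · by_contra! h
    have hab' : ϖ = (a : K) * b := congrArg Subtype.val hab
    have h2 : V.nnVal ϖ = V.nnVal a * V.nnVal b := by
      conv_lhs => rw [hab', map_mul]
    have ha := hmax _ (hlt a h.1)
    have h3 : V.nnVal ϖ < V.nnVal ϖ := calc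
      V.nnVal ϖ = V.nnVal a * V.nnVal b := h2
      _ ≤ V.nnVal ϖ * V.nnVal b := by gcongr
      _ < V.nnVal ϖ := mul_lt_of_lt_one_right hpos (hlt b h.2)
    exact lt_irrefl _ h3
  · have hx0 : (x : K) ≠ 0 := by simpa using hx
    obtain ⟨n, hn1, hn2⟩ := exists_nat_pow_near_of_lt_one (V.nnVal.pos_iff.mpr hx0)
      (nnVal_le_one_iff.mpr x.2) hpos h1
    have hpown : 0 < V.nnVal ϖ ^ n := pow_pos hpos n
    have hz1 : V.nnVal ((x : K) / ϖ ^ n) ≤ 1 := by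
      rw [map_div₀, map_pow]
      exact (div_le_one₀ hpown).mpr hn2
    have hz : V.nnVal ((x : K) / ϖ ^ n) = 1 := by
      refine hz1.eq_of_not_lt fun h => (hmax _ h).not_gt ?_
      rw [map_div₀, map_pow, lt_div_iff₀ hpown, ← pow_succ']
      exact hn1
    obtain ⟨y, hy⟩ := isUnit_of_nnVal_eq_one ⟨_, nnVal_le_one_iff.mp hz1⟩ hz
    refine ⟨n, y, Subtype.ext ?_⟩
    rw [hy]
    change ϖ ^ n * ((x : K) / ϖ ^ n) = x
    exact mul_div_cancel₀ _ (pow_ne_zero n h0)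

theorem exists_nnVal_mem_Ioo (hV : ¬ IsDiscreteValuationRing V) {ε : ℝ≥0} (hε : 1 < ε) :
    ∃ x, 1 < V.nnVal x ∧ V.nnVal x < ε := by
  set S : Set ℝ≥0 := {r | r < 1 ∧ ∃ x ≠ 0, V.nnVal x = r} with hS
  have hbdd : BddAbove S := ⟨1, fun r hr => hr.1.le⟩
  obtain ⟨x₀, hx₀, hx₀1⟩ := exists_nnVal_lt (V := V) one_ne_zero
  have hmem : V.nnVal x₀ ∈ S := ⟨hx₀1, x₀, hx₀, rfl⟩
  have hlub := isLUB_csSup ⟨_, hmem⟩ hbdd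
  set M := sSup S
  have hM : 0 < M := (V.nnVal.pos_iff.mpr hx₀).trans_le (hlub.1 hmem)
  -- Two distinct values in `(M/ε, M]`, where `M` is the supremum of the values below `1`, have a
  -- quotient in `(1, ε)`.
  obtain ⟨_, ⟨hx1, x, hx, rfl⟩, hMx⟩ := (lt_isLUB_iff hlub).mp
    (div_lt_self hM hε)
  obtain ⟨y, hy1, hxy⟩ : ∃ y, V.nnVal y < 1 ∧ V.nnVal x < V.nnVal y := by
    by_contra! h
    exact hV (isDiscreteValuationRing_of_nnVal_le hx hx1 h)
  have hxpos : 0 < V.nnVal x := V.nnVal.pos_iff.mpr hx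
  have hy0 : y ≠ 0 := V.nnVal.pos_iff.mp (hxpos.trans hxy)
  have hyM : V.nnVal y ≤ M := hlub.1 ⟨hy1, y, hy0, rfl⟩
  refine ⟨y / x, ?_, ?_⟩
  · rw [map_div₀]
    exact (one_lt_div₀ hxpos).mpr hxy
  · rw [map_div₀, div_lt_iff₀ hxpos]
    rw [div_lt_iff₀ (zero_lt_one.trans hε), mul_comm] at hMx
    exact hyM.trans_lt hMx

theorem exists_seq_nnVal_tendsto_one (hV : ¬ IsDiscreteValuationRing V) :
    ∃ e : ℕ → K, StrictAnti (fun n => V.nnVal (e n)) ∧ (∀ n, 1 < V.nnVal (e n)) ∧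
      Tendsto (fun n => V.nnVal (e n)) atTop (𝓝 1) := by
  set S : Set ℝ≥0 := {r | 1 < r ∧ ∃ x, V.nnVal x = r} with hS
  have hglb : IsGLB S 1 := by
    refine ⟨fun r hr => hr.1.le, fun b hb => ?_⟩
    by_contra! h
    obtain ⟨x, hx1, hxb⟩ := exists_nnVal_mem_Ioo hV h
    exact (hb ⟨hx1, x, rfl⟩).not_gt hxb
  obtain ⟨x, hx, -⟩ := exists_nnVal_mem_Ioo hV one_lt_two
  obtain ⟨r, hr, hr1, hlim, hmem⟩ := hglb.exists_seq_strictAnti_tendsto_of_notMem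
    (fun h => lt_irrefl _ h.1) ⟨_, hx, x, rfl⟩
  choose e he using fun n => (hmem n).2
  obtain rfl : (fun n => V.nnVal (e n)) = r := funext he
  exact ⟨e, hr, hr1, hlim⟩

/-! ### Pseudo-convergent sequences of prescribed breadth. -/

theorem nnVal_affine_sub {e : ℕ → K} (he : StrictAnti fun n => V.nnVal (e n)) (b z : K) (n : ℕ) :
    V.nnVal ((b + z * e (n + 1)) - (b + z * e n)) = V.nnVal z * V.nnVal (e n) := by
  rw [show (b + z * e (n + 1)) - (b + z * e n) = z * (e (n + 1) - e n) by ring, map_mul,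
    V.nnVal.map_sub_eq_of_lt_right (he n.lt_succ_self)]

theorem isPseudoConvergent_affine {e : ℕ → K} (he : StrictAnti fun n => V.nnVal (e n))
    (b : K) {z : K} (hz : z ≠ 0) :
    IsPseudoConvergent V.valuation fun n => b + z * e n := fun n => by
  rw [← nnVal_lt_iff, nnVal_affine_sub he, nnVal_affine_sub he]
  exact mul_lt_mul_of_pos_left (he n.lt_succ_self) (V.nnVal.pos_iff.mpr hz)

theorem hasBreadth_affine {e : ℕ → K} (he : StrictAnti fun n => V.nnVal (e n))
    (hlim : Tendsto (fun n => V.nnVal (e n)) atTop (𝓝 1)) (b z : K) :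
    HasBreadth V.valuation (fun n => b + z * e n) (addVal V.valuation z) := by
  simp only [HasBreadth, addVal_eq, nnVal_affine_sub he]
  have h := hlim.const_mul (V.nnVal z)
  rw [mul_one] at h
  exact ((ENNReal.continuous_log.tendsto _).comp (ENNReal.tendsto_coe.mpr h)).neg

theorem addVal_lt_of_nnVal_lt {x y : K} (h : V.nnVal x < V.nnVal y) :
    addVal V.valuation y < addVal V.valuation x := by
  rw [addVal_eq, addVal_eq, EReal.neg_lt_neg_iff]
  exact ENNReal.log_strictMono (ENNReal.coe_lt_coe.mpr h)

theorem exists_addVal_lt {δ : EReal} (hδ : δ ≠ ⊥) : ∃ z : K, z ≠ 0 ∧ addVal V.valuation z < δ := by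
  have htop : EReal.exp (-δ) < ⊤ := by
    rw [EReal.exp_lt_top_iff, lt_top_iff_ne_top, Ne, EReal.neg_eq_top_iff]
    exact hδ
  lift EReal.exp (-δ) to ℝ≥0 using htop.ne with r hr
  -- Adding `1` covers `δ = ⊤`, where `r = 0`.
  obtain ⟨x, hx, hxr⟩ := exists_nnVal_lt (V := V) (γ := (r + 1)⁻¹) (by positivity)
  refine ⟨x⁻¹, inv_ne_zero hx, ?_⟩
  rw [addVal_eq, EReal.neg_lt_comm, ← EReal.log_exp (-δ), ← hr]
  refine ENNReal.log_strictMono (ENNReal.coe_lt_coe.mpr ?_)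
  rw [map_inv₀]
  rw [lt_inv_comm₀ (V.nnVal.pos_iff.mpr hx) (by positivity)] at hxr
  exact (lt_add_one r).trans hxr

/-! ### Reduction of polynomial inequalities to the residue field. -/

/-- A nonzero polynomial is a constant times a polynomial over `V` with nonzero reduction. -/
theorem exists_eq_C_mul_map {f : K[X]} (hf : f ≠ 0) :
    ∃ (b : K) (F : V[X]), b ≠ 0 ∧ F.map (IsLocalRing.residue V) ≠ 0 ∧
      f = C b * F.map (algebraMap V K) := by
  obtain ⟨i, hi, hmax⟩ := f.support.exists_max_image (fun i => V.nnVal (f.coeff i))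
    (by simpa using hf)
  have hb : f.coeff i ≠ 0 := mem_support_iff.mp hi
  have hbpos : 0 < V.nnVal (f.coeff i) := V.nnVal.pos_iff.mpr hb
  have hmem : C (f.coeff i)⁻¹ * f ∈ Polynomial.lifts (algebraMap V K) := by
    rw [Polynomial.lifts_iff_coeff_lifts]
    intro n
    refine ⟨⟨(C (f.coeff i)⁻¹ * f).coeff n, nnVal_le_one_iff.mp ?_⟩, rfl⟩
    rw [coeff_C_mul, map_mul, map_inv₀, mul_comm, ← div_eq_mul_inv, div_le_one₀ hbpos]
    by_cases hn : n ∈ f.support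
    · exact hmax n hn
    · simp [notMem_support_iff.mp hn]
  obtain ⟨F, hF⟩ := (Polynomial.mem_lifts _).mp hmem
  refine ⟨f.coeff i, F, hb, fun h => ?_, ?_⟩
  · have h1 : (algebraMap V K) (F.coeff i) = 1 := by
      rw [← coeff_map, hF, coeff_C_mul, inv_mul_cancel₀ hb]
    have h2 : F.coeff i = 1 := Subtype.ext h1
    have h3 := congrArg (fun p => p.coeff i) h
    simp [h2] at h3
  · rw [hF, ← mul_assoc, ← C_mul, mul_inv_cancel₀ hb, C_1, one_mul]

theorem nnVal_eval_map_le (F : V[X]) {x : K} (hx : 1 ≤ V.nnVal x) :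
    V.nnVal ((F.map (algebraMap V K)).eval x) ≤ V.nnVal x ^ F.natDegree := by
  rw [eval_map, eval₂_eq_sum_range]
  refine V.nnVal.map_sum_le fun i hi => ?_
  rw [map_mul, map_pow]
  calc V.nnVal (F.coeff i) * V.nnVal x ^ i ≤ 1 * V.nnVal x ^ F.natDegree := by
        gcongr
        · exact nnVal_le_one_iff.mpr (F.coeff i).2
        · exact Nat.lt_succ_iff.mp (Finset.mem_range.mp hi)
    _ = _ := one_mul _

/-- The term at the degree `d` of the reduction eventually dominates: lower terms carry smaller
powers, and higher coefficients have value below `1` while the powers of `|e n|` tend to `1`. -/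
theorem eventually_one_le_nnVal_eval_map {F : V[X]} (hF : F.map (IsLocalRing.residue V) ≠ 0)
    {e : ℕ → K} (he : ∀ n, 1 < V.nnVal (e n))
    (hlim : Tendsto (fun n => V.nnVal (e n)) atTop (𝓝 1)) :
    ∀ᶠ n in atTop, 1 ≤ V.nnVal ((F.map (algebraMap V K)).eval (e n)) := by
  set d := (F.map (IsLocalRing.residue V)).natDegree with hd
  have hdF : d ∈ Finset.range (F.natDegree + 1) :=
    Finset.mem_range.mpr (Nat.lt_succ_of_le natDegree_map_le)
  have hunit : V.nnVal (F.coeff d) = 1 := by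
    refine (nnVal_le_one_iff.mpr (F.coeff d).2).eq_of_not_lt fun h => ?_
    rw [nnVal_lt_one_iff, ← coeff_map] at h
    exact hF (leadingCoeff_eq_zero.mp h)
  have hterm : ∀ i, i ≠ d → ∀ᶠ n in atTop,
      V.nnVal (F.coeff i * e n ^ i) < V.nnVal (F.coeff d * e n ^ d) := by
    intro i hi
    simp only [map_mul, map_pow, hunit, one_mul]
    rcases hi.lt_or_gt with hi | hi
    · refine Eventually.of_forall fun n => ?_
      calc V.nnVal (F.coeff i) * V.nnVal (e n) ^ i ≤ 1 * V.nnVal (e n) ^ i := by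
            gcongr
            exact nnVal_le_one_iff.mpr (F.coeff i).2
        _ < V.nnVal (e n) ^ d := by
            rw [one_mul]
            exact pow_lt_pow_right₀ (he n) hi
    · have hsmall : V.nnVal (F.coeff i) < 1 := by
        rw [nnVal_lt_one_iff, ← coeff_map]
        exact coeff_eq_zero_of_natDegree_lt hi
      have h1 : Tendsto (fun n => V.nnVal (F.coeff i) * V.nnVal (e n) ^ i) atTop
          (𝓝 (V.nnVal (F.coeff i))) := by
        simpa using (hlim.pow i).const_mul (V.nnVal (F.coeff i))
      filter_upwards [h1.eventually_lt_const hsmall] with n hn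
      exact hn.trans_le (one_le_pow₀ (he n).le)
  have hall : ∀ᶠ n in atTop, ∀ i ∈ Finset.range (F.natDegree + 1) \ {d},
      V.nnVal (F.coeff i * e n ^ i) < V.nnVal (F.coeff d * e n ^ d) :=
    (eventually_all_finset _).mpr fun i hi => hterm i (by simpa using (Finset.mem_sdiff.mp hi).2)
  filter_upwards [hall] with n hn
  rw [eval_map, eval₂_eq_sum_range]
  have := V.nnVal.map_sum_eq_of_lt hdF hn
  refine le_of_le_of_eq ?_ this.symm
  rw [map_mul, hunit, one_mul, map_pow]
  exact one_le_pow₀ (he n).le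

/-- A polynomial inequality that holds as `|x|` decreases to `1` holds at all `x ∈ V` outside
finitely many residue classes. -/
theorem exists_residue_polynomial {f g : K[X]} (hg : g ≠ 0) {e : ℕ → K}
    (he : ∀ n, 1 < V.nnVal (e n)) (hlim : Tendsto (fun n => V.nnVal (e n)) atTop (𝓝 1))
    (hfg : ∀ᶠ n in atTop, V.nnVal (f.eval (e n)) ≤ V.nnVal (g.eval (e n))) :
    ∃ h : (IsLocalRing.ResidueField V)[X], h ≠ 0 ∧ ∀ x : V,
      h.eval (IsLocalRing.residue V x) ≠ 0 → V.nnVal (f.eval (x : K)) ≤ V.nnVal (g.eval (x : K)) := by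
  rcases eq_or_ne f 0 with rfl | hf
  · exact ⟨1, one_ne_zero, by simp⟩
  obtain ⟨b, F, hb, hF, rfl⟩ := exists_eq_C_mul_map (V := V) hf
  obtain ⟨c, G, hc, hG, rfl⟩ := exists_eq_C_mul_map (V := V) hg
  simp only [eval_mul, eval_C, map_mul] at hfg ⊢
  -- Letting `|e n|` tend to `1` compares the contents: the factor from `F` is at least `1`, and the
  -- one from `G` is at most a power of `|e n|`.
  have hbc : V.nnVal b ≤ V.nnVal c := by
    have h1 : Tendsto (fun n => V.nnVal c * V.nnVal (e n) ^ G.natDegree) atTop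
        (𝓝 (V.nnVal c)) := by
      simpa using (hlim.pow G.natDegree).const_mul (V.nnVal c)
    refine ge_of_tendsto h1 ?_
    filter_upwards [hfg, eventually_one_le_nnVal_eval_map hF he hlim] with n hn hn'
    calc V.nnVal b ≤ V.nnVal b * V.nnVal ((F.map (algebraMap V K)).eval (e n)) :=
          le_mul_of_one_le_right zero_le hn'
      _ ≤ _ := hn
      _ ≤ _ := by gcongr; exact nnVal_eval_map_le G (he n).le
  have heval : ∀ (P : V[X]) (x : V), (P.map (algebraMap V K)).eval (x : K) = (P.eval x : V) :=
    fun P x => eval_map_algebraMap P (x : K) ▸ Polynomial.aeval_algebraMap_apply_eq_algebraMap_eval x P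
  refine ⟨_, hG, fun x hx => ?_⟩
  have hGx : V.nnVal ((G.map (algebraMap V K)).eval (x : K)) = 1 := by
    rw [heval]
    refine (nnVal_le_one_iff.mpr (G.eval x).2).eq_of_not_lt fun h => hx ?_
    rw [eval_map_apply, (nnVal_lt_one_iff _).mp h]
  have hFx : V.nnVal ((F.map (algebraMap V K)).eval (x : K)) ≤ 1 := by
    rw [heval]
    exact nnVal_le_one_iff.mpr (F.eval x).2
  rw [hGx]
  gcongr

/-! ### Infinite residue field: the topologies differ. -/

theorem finite_residueField_of_topologiesCoincideOn (hV : ¬ IsDiscreteValuationRing V)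
    {δ : EReal} (hδ : δ ≠ ⊥) (h : Zar.TopologiesCoincideOn (⋃ δ' < δ, V.seqStratum δ')) :
    Finite (IsLocalRing.ResidueField V) := by
  classical
  by_contra hfin
  rw [not_finite_iff_infinite] at hfin
  obtain ⟨e, hanti, he, hlim⟩ := exists_seq_nnVal_tendsto_one hV
  obtain ⟨z, hz, hzδ⟩ := exists_addVal_lt (V := V) hδ
  -- The factor `t` puts every `t * e n` in the maximal ideal, so with `z = c * t` the terms `c * a
  -- + z * e n` are `c` times elements of the residue class of `a`.
  obtain ⟨t, ht, hte⟩ := exists_nnVal_lt (V := V) (γ := (V.nnVal (e 0))⁻¹)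
    (inv_ne_zero (zero_lt_one.trans (he 0)).ne')
  have hte' : ∀ n, V.nnVal (t * e n) < 1 := fun n => by
    rw [map_mul]
    calc V.nnVal t * V.nnVal (e n) ≤ V.nnVal t * V.nnVal (e 0) := by
          gcongr
          exact hanti.antitone n.zero_le
      _ < 1 := by rwa [← lt_div_iff₀ (zero_lt_one.trans (he 0)), one_div]
  set c := z / t with hc
  have hc0 : c ≠ 0 := div_ne_zero hz ht
  have hct : c * t = z := div_mul_cancel₀ z ht
  have hcδ : addVal V.valuation c < δ := by
    refine (addVal_lt_of_nnVal_lt ?_).trans hzδ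
    rw [← hct, map_mul]
    refine mul_lt_of_lt_one_right (V.nnVal.pos_iff.mpr hc0) (hte.trans ?_)
    exact inv_lt_one_of_one_lt₀ (he 0)
  have hs := isPseudoConvergent_affine hanti 0 hc0
  have hCc : (C c : K[X]) ≠ 0 := C_ne_zero.mpr hc0
  have hsY : V.seqPoint _ hs ∈ ⋃ δ' < δ, V.seqStratum δ' :=
    Set.mem_biUnion hcδ ⟨_, hs, hasBreadth_affine hanti hlim 0 c, rfl⟩
  obtain ⟨S, hS, hSφ⟩ := Zar.topologiesCoincideOn_iff.mp h _ hsY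
    (algebraMap K[X] (RatFunc K) X / algebraMap K[X] (RatFunc K) (C c)) (by
      change _ ∉ V.ofPseudoConvergent _ hs
      rw [div_mem_ofPseudoConvergent_iff hs _ hCc]
      intro hev
      obtain ⟨n, hn⟩ := hev.exists
      rw [← nnVal_le_iff, eval_X, eval_C, zero_add, map_mul] at hn
      exact hn.not_gt (lt_mul_of_one_lt_right (V.nnVal.pos_iff.mpr hc0) (he n)))
  have hres : ∀ φ ∈ S, ∃ p : (IsLocalRing.ResidueField V)[X], p ≠ 0 ∧ ∀ x : V,
      p.eval (IsLocalRing.residue V x) ≠ 0 →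
        V.nnVal (φ.num.eval (c * x)) ≤ V.nnVal (φ.denom.eval (c * x)) := by
    intro φ hφ
    have hφ' : φ ∈ V.ofPseudoConvergent _ hs := hS φ hφ
    rw [← φ.num_div_denom, div_mem_ofPseudoConvergent_iff hs _ φ.denom_ne_zero] at hφ'
    have hg : φ.denom.comp (C c * X) ≠ 0 := by
      rw [Ne, comp_C_mul_X_eq_zero_iff (mem_nonZeroDivisors_of_ne_zero hc0)]
      exact φ.denom_ne_zero
    obtain ⟨p, hp, hpx⟩ := exists_residue_polynomial (f := φ.num.comp (C c * X)) hg he hlim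
      (hφ'.mono fun n hn => by simpa [nnVal_le_iff] using hn)
    exact ⟨p, hp, fun x hx => by simpa using hpx x hx⟩
  choose! p hp hpx using hres
  -- Infinitude of the residue field yields a class that avoids all the exceptional ones.
  obtain ⟨r, hr⟩ : ∃ r, (∏ φ ∈ S, p φ).eval r ≠ 0 := by
    by_contra! h0
    exact Finset.prod_ne_zero_iff.mpr hp (Polynomial.funext fun r => by rw [h0, eval_zero])
  obtain ⟨a, rfl⟩ := IsLocalRing.residue_surjective r
  rw [eval_prod, Finset.prod_ne_zero_iff] at hr
  have hs' := isPseudoConvergent_affine hanti (c * a) hz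
  have hterm : ∀ n, ∃ x : V, c * a + z * e n = c * x ∧
      IsLocalRing.residue V x = IsLocalRing.residue V a := by
    intro n
    set y : V := ⟨t * e n, nnVal_le_one_iff.mp (hte' n).le⟩ with hy
    refine ⟨a + y, ?_, ?_⟩
    · rw [← hct, mul_assoc, ← mul_add]
      rfl
    · rw [map_add, (nnVal_lt_one_iff y).mp (hte' n), add_zero]
  refine hSφ (V.seqPoint _ hs') (Set.mem_biUnion hzδ
    ⟨_, hs', hasBreadth_affine hanti hlim _ z, rfl⟩) (fun φ hφ => ?_) ?_
  · change φ ∈ V.ofPseudoConvergent _ hs'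
    rw [← φ.num_div_denom, div_mem_ofPseudoConvergent_iff hs' _ φ.denom_ne_zero]
    refine Eventually.of_forall fun n => ?_
    obtain ⟨x, hx, hxa⟩ := hterm n
    rw [hx, ← nnVal_le_iff]
    exact hpx φ hφ x (by rw [hxa]; exact hr φ hφ)
  · change _ ∈ V.ofPseudoConvergent _ hs'
    rw [div_mem_ofPseudoConvergent_iff hs' _ hCc]
    refine Eventually.of_forall fun n => ?_
    obtain ⟨x, hx, -⟩ := hterm n
    rw [hx, ← nnVal_le_iff, eval_X, eval_C, map_mul]
    exact mul_le_of_le_one_right zero_le (nnVal_le_one_iff.mpr x.2)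

end ValuationSubring

/-- The condition `δ ≠ ⊥` cuts `EReal` down to `ℝ ∪ {+∞}`; for `δ = ⊥` the union in the last item is
empty and coincidence is trivial. -/
theorem proposition6p8 {K : Type*} [Field K] (V : ValuationSubring K) [V.valuation.RankOne]
    (hV : ¬ IsDiscreteValuationRing V) :
    List.TFAE [
      Finite (IsLocalRing.ResidueField V),
      Zar.TopologiesCoincideOn V.seqSpace,
      ∃ δ : EReal, δ ≠ ⊥ ∧ Zar.TopologiesCoincideOn (⋃ δ' ≤ δ, V.seqStratum δ'),
      ∃ δ : EReal, δ ≠ ⊥ ∧ Zar.TopologiesCoincideOn (⋃ δ' < δ, V.seqStratum δ')] := by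
  have stratum_subset (δ : EReal) : V.seqStratum δ ⊆ V.seqSpace :=
    fun _ ⟨s, hs, _, h⟩ => ⟨s, hs, h⟩
  tfae_have 1 → 2 := fun _ => V.topologiesCoincideOn_seqSpace
  tfae_have 2 → 3 := fun h => ⟨⊤, top_ne_bot, h.mono (Set.iUnion₂_subset fun δ _ =>
    stratum_subset δ)⟩
  tfae_have 3 → 4 := fun ⟨δ, hδ, h⟩ => ⟨δ, hδ, h.mono (Set.iUnion₂_subset fun δ' hδ' =>
    Set.subset_iUnion₂_of_subset δ' hδ'.le subset_rfl)⟩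
  tfae_have 4 → 1 := fun ⟨_, hδ, h⟩ =>
    ValuationSubring.finite_residueField_of_topologiesCoincideOn hV hδ h
  tfae_finish
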